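/- Let $d\ge 0$, $\tau\in[0,1)$, let $f:[0,\infty)\to\mathbb R$ be continuously differentiable, strictly convex and increasing, let $v^{\rm base}:\mathbb R^d\times[\tau,1]\to\mathbb R^d$ be jointly continuous and differentiable in $x$ with $\nabla_x v^{\rm base}$ jointly continuous, and let $g:\mathbb R^d\to\mathbb R$ be differentiable. For $x\in\mathbb R^d$ consider the deterministic control problem $$\min_u\ \int_\tau^1 f(\|u(X_t,t)\|)\,dt+g(X_1)\quad\text{subject to}\quad \dot X_t=v^{\rm base}(X_t,t)+u(X_t,t),\quad X_\tau=x,$$ over all pairs $(X,u)$ such that $u:\mathbb R^d\times[\tau,1]\to\mathbb R^d$, $t\mapsto u(X_t,t)$ and $t\mapsto f(\|u(X_t,t)\|)$ are Lebesgue integrable on $[\tau,1]$, and $X$ is continuous and satisfies the dynamics in integrated form. Assume that the minimum is attained, and let $(X,u)$ be any minimizing pair. Write $(f')^{-1}(y)$ for the unique $r\ge 0$ with $f'(r)=y$ (derivative one-sided at $0$), with value $0$ if $y<f'(0)$ (and, by convention, $0$ also if $y$ exceeds all values of $f'$); read the formulas below as $0$ where $a_t=0$. Then the costate equation $$\dot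 a_t=-\big(\nabla_x v^{\rm base}(X_t,t)\big)^{\top}a_t\quad(t\in[\tau,1]),\qquad a_1=\nabla g(X_1)$$ has a solution on $[\tau,1]$, and for every solution $a$ of it: 1. for almost every $t\in[\tau,1]$, $\|a_t\|$ is either smaller than $f'(0)$ or a value of $f'$ on $[0,\infty)$, and $u(X_t,t)=-\dfrac{(f')^{-1}(\|a_t\|)}{\|a_t\|}\,a_t$; 2. the control given for all $t\in[\tau,1]$ by $u^\star_t=-\dfrac{(f')^{-1}(\|a_t\|)}{\|a_t\|}\,a_t$ is an optimal control, with the same trajectory $X$; 3. if $f(r)=\dfrac{r^p}{p\lambda}$ for $r\ge0$, with $p>1$ and $\lambda>0$, then $u^\star_t=-\lambda^{1/(p-1)}\|a_t\|^{(2-p)/(p-1)}a_t$ for all $t\in[\tau,1]$. -/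

import Mathlib

open MeasureTheory

/-- `(X, u)` is an admissible pair on `[τ, 1]` from the state `x`: the control `u = u(x, t)`, evaluated
along `X`, is integrable and has integrable running cost, and the continuous path `X` is a
(Carathéodory) solution of `Ẋ = v(X, t) + u(X, t)`, `X τ = x`. Open-loop controls are the `u` that do
not depend on their first argument. -/
structure IsAdmissiblePair {d : ℕ} (f : ℝ → ℝ)
    (v : EuclideanSpace ℝ (Fin d) → ℝ → EuclideanSpace ℝ (Fin d)) (τ : ℝ)
    (x : EuclideanSpace ℝ (Fin d)) (X : ℝ → EuclideanSpace ℝ (Fin d))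
    (u : EuclideanSpace ℝ (Fin d) → ℝ → EuclideanSpace ℝ (Fin d)) : Prop where
  control_integrable : IntegrableOn (fun t => u (X t) t) (Set.Icc τ 1) volume
  cost_integrable : IntegrableOn (fun t => f ‖u (X t) t‖) (Set.Icc τ 1) volume
  continuousOn : ContinuousOn X (Set.Icc τ 1)
  dynamics : ∀ t ∈ Set.Icc τ 1, X t = x + ∫ s in τ..t, (v (X s) s + u (X s) s)

/-- The cost `∫_τ^1 f(‖u(X_t, t)‖) dt + g(X_1)`. -/
noncomputable def controlCost {d : ℕ} (f : ℝ → ℝ) (g : EuclideanSpace ℝ (Fin d) → ℝ) (τ : ℝ)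
    (X : ℝ → EuclideanSpace ℝ (Fin d))
    (u : EuclideanSpace ℝ (Fin d) → ℝ → EuclideanSpace ℝ (Fin d)) : ℝ :=
  (∫ t in τ..1, f ‖u (X t) t‖) + g (X 1)

/-- `u` is an optimal control with trajectory `X`. -/
def IsOptimalPair {d : ℕ} (f : ℝ → ℝ) (g : EuclideanSpace ℝ (Fin d) → ℝ)
    (v : EuclideanSpace ℝ (Fin d) → ℝ → EuclideanSpace ℝ (Fin d)) (τ : ℝ)
    (x : EuclideanSpace ℝ (Fin d)) (X : ℝ → EuclideanSpace ℝ (Fin d))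
    (u : EuclideanSpace ℝ (Fin d) → ℝ → EuclideanSpace ℝ (Fin d)) : Prop :=
  IsAdmissiblePair f v τ x X u ∧
    ∀ X' u', IsAdmissiblePair f v τ x X' u' → controlCost f g τ X u ≤ controlCost f g τ X' u'

/-- `a` is the costate (adjoint state) along `X`: `ȧ = -(∇ₓ v(X_t, t))ᵀ a` on `[τ, 1]` and
`a_1 = ∇g(X_1)`. -/
structure IsCostate {d : ℕ} (g : EuclideanSpace ℝ (Fin d) → ℝ)
    (v : EuclideanSpace ℝ (Fin d) → ℝ → EuclideanSpace ℝ (Fin d)) (τ : ℝ)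
    (X a : ℝ → EuclideanSpace ℝ (Fin d)) : Prop where
  ode : ∀ t ∈ Set.Icc τ 1,
    HasDerivWithinAt a
      (-(ContinuousLinearMap.adjoint (fderiv ℝ (fun y => v y t) (X t)) (a t))) (Set.Icc τ 1) t
  terminal : a 1 = gradient g (X 1)

/-- The derivative `f'` of `f` on `[0, ∞)` (one-sided at `0`). -/
noncomputable def costDeriv (f : ℝ → ℝ) (r : ℝ) : ℝ :=
  derivWithin f (Set.Ici 0) r

open Classical in
/-- The inverse `(f')⁻¹(y)`: the `r ≥ 0` with `f'(r) = y` (unique for strictly convex `f`). If there is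
none the value is `0`, which for `y < f'(0)` is the usual generalized inverse. -/
noncomputable def costDerivInv (f : ℝ → ℝ) (y : ℝ) : ℝ :=
  if h : ∃ r : ℝ, 0 ≤ r ∧ costDeriv f r = y then h.choose else 0

/-- The vector `-((f')⁻¹(‖a‖) / ‖a‖) a`, which is `0` for `a = 0`. -/
noncomputable def controlLaw {d : ℕ} (f : ℝ → ℝ) (a : EuclideanSpace ℝ (Fin d)) :
    EuclideanSpace ℝ (Fin d) :=
  -((costDerivInv f ‖a‖ / ‖a‖) • a)

/-!
The statement is a Pontryagin principle, proved by a first variation in which competitors are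
prescribed through their paths instead of their controls: an absolutely continuous path `Y` is
driven by the control `Y' - v(Y, t)`, so no nonlinear equation has to be solved.

Write `w t = u (X t) t`, let `z` be bounded and measurable, and let `ξ` solve the linearized equation
`ξ' = ∇v(X, t) ξ + (z - w)`, `ξ τ = 0`. The path `X + ε ξ` is driven by `(1 - ε) w + ε (z - ρ_ε)`
with a rescaled linearization error `ρ_ε` that is bounded and tends to `0` pointwise
(`linearization_error`). Since `f ‖·‖` is convex, its running cost is at most
`(1 - ε) ∫ f ‖w‖ + ε ∫ f ‖z - ρ_ε‖`, which is finite however fast `f` grows. Optimality and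
`ε → 0⁺` give `∫ f ‖w‖ ≤ ∫ f ‖z‖ + ⟪∇g (X 1), ξ 1⟫` (`integral_cost_le_of_linearized`).

For a costate `a`, integration by parts (`integral_inner_parts_of_primitive`) turns the last term into
`∫ ⟪a, z - w⟫`. Hence `w` minimizes `z ↦ ∫ f ‖z‖ + ⟪a, z⟫` among bounded `z`, and localizing
(`ae_minimizes_of_integral_le`) shows that for almost every `t` the vector `w t` minimizes the
Hamiltonian `y ↦ f ‖y‖ + ⟪a t, y⟫`. By Cauchy-Schwarz and the radial first-order condition its only
possible minimizer is the control law, and the existence of a minimizer forces `‖a t‖` to be below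
`f' 0` or a value of `f'` (`eq_controlLaw_of_minimizes`). The control law thus agrees with `w` almost
everywhere along `X`, so it is optimal with the same trajectory.

The linear equations for `ξ` and for the costate are both solved by `exists_continuous_volterra`.
-/

/-! ### Linear differential equations -/

/-- Linear Volterra equations with continuous data are solvable on all of `[τ, T]`. After the
substitution `y t = exp (M t) φ t` with `M > sup ‖A‖` the right-hand side is a contraction in the
uniform norm. -/
lemma exists_continuous_volterra {E : Type*} [NormedAddCommGroup E] [NormedSpace ℝ E]
    [CompleteSpace E] {τ T : ℝ} (hτT : τ ≤ T) {A : ℝ → E →L[ℝ] E} (hA : Continuous A)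
    {b : ℝ → E} (hb : Continuous b) :
    ∃ y : ℝ → E, Continuous y ∧
      ∀ t ∈ Set.Icc τ T, y t = b t + ∫ s in τ..t, A s (y s) := by
  obtain ⟨K', hK'⟩ := isCompact_Icc.exists_bound_of_continuousOn (s := Set.Icc τ T) hA.continuousOn
  obtain ⟨K, hK0, hK⟩ : ∃ K : ℝ, 0 ≤ K ∧ ∀ s ∈ Set.Icc τ T, ‖A s‖ ≤ K :=
    ⟨max K' 0, le_max_right _ _, fun s hs => (hK' s hs).trans (le_max_left _ _)⟩
  set M : ℝ := K + 1 with hM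
  have hM0 : 0 < M := by positivity
  have hcont (φ : C(Set.Icc τ T, E)) :
      Continuous fun s => Real.exp (M * s) • A s (Set.IccExtend hτT φ s) := by
    have : Continuous (Set.IccExtend hτT φ) := φ.continuous.Icc_extend'
    fun_prop
  -- the integral operator for `φ`, where `y t = exp (M t) φ t`
  let Φ : C(Set.Icc τ T, E) → C(Set.Icc τ T, E) := fun φ =>
    ⟨fun t => Real.exp (-(M * t)) •
      (b t + ∫ s in τ..t, Real.exp (M * s) • A s (Set.IccExtend hτT φ s)), by
      have h1 : Continuous fun t : ℝ =>
          ∫ s in τ..t, Real.exp (M * s) • A s (Set.IccExtend hτT φ s) :=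
        intervalIntegral.continuous_primitive (fun _ _ => (hcont φ).intervalIntegrable _ _) τ
      have h2 : Continuous fun t : ℝ => Real.exp (-(M * t)) •
          (b t + ∫ s in τ..t, Real.exp (M * s) • A s (Set.IccExtend hτT φ s)) := by
        fun_prop
      exact h2.comp continuous_subtype_val⟩
  have hexp (t : ℝ) : ∫ s in τ..t, Real.exp (M * s) * M = Real.exp (M * t) - Real.exp (M * τ) := by
    refine intervalIntegral.integral_eq_sub_of_hasDerivAt (f := fun s => Real.exp (M * s))
      (fun s _ => ?_) (Continuous.intervalIntegrable (by fun_prop) _ _)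
    simpa using ((hasDerivAt_id s).const_mul M).exp
  have hΦ : ContractingWith (NNReal.mk (K / M) (by positivity)) Φ := by
    refine ⟨?_, LipschitzWith.of_dist_le_mul fun φ ψ => ?_⟩
    · rw [← NNReal.coe_lt_coe]
      rw [NNReal.coe_mk, NNReal.coe_one, div_lt_one hM0]
      linarith
    · refine (ContinuousMap.dist_le (mul_nonneg (NNReal.coe_nonneg _) dist_nonneg)).2 fun t => ?_
      have hD (s : ℝ) : ‖Set.IccExtend hτT φ s - Set.IccExtend hτT ψ s‖ ≤ dist φ ψ := by
        rw [← dist_eq_norm]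
        exact ContinuousMap.dist_apply_le_dist _
      have hsub : Φ φ t - Φ ψ t = Real.exp (-(M * t)) • ∫ s in τ..t, Real.exp (M * s) •
          A s (Set.IccExtend hτT φ s - Set.IccExtend hτT ψ s) := by
        simp only [Φ, ContinuousMap.coe_mk, ← smul_sub, add_sub_add_left_eq_sub, map_sub]
        rw [← intervalIntegral.integral_sub ((hcont φ).intervalIntegrable _ _)
          ((hcont ψ).intervalIntegrable _ _)]
        simp only [smul_sub]
      have hbound : ‖∫ s in τ..t, Real.exp (M * s) •
          A s (Set.IccExtend hτT φ s - Set.IccExtend hτT ψ s)‖ ≤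
          ∫ s in τ..t, (K / M * dist φ ψ) * (Real.exp (M * s) * M) := by
        refine intervalIntegral.norm_integral_le_of_norm_le t.2.1 (ae_of_all _ fun s hs => ?_)
          (Continuous.intervalIntegrable (by fun_prop) _ _)
        rw [norm_smul, Real.norm_of_nonneg (Real.exp_pos _).le]
        calc Real.exp (M * s) * ‖A s (Set.IccExtend hτT φ s - Set.IccExtend hτT ψ s)‖
            ≤ Real.exp (M * s) * (K * dist φ ψ) := by
              gcongr
              exact (A s).le_of_opNorm_le_of_le (hK s ⟨hs.1.le, hs.2.trans t.2.2⟩) (hD s)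
          _ = (K / M * dist φ ψ) * (Real.exp (M * s) * M) := by field_simp
      rw [intervalIntegral.integral_const_mul, hexp] at hbound
      rw [dist_eq_norm, hsub, norm_smul, Real.norm_of_nonneg (Real.exp_pos _).le, NNReal.coe_mk]
      calc Real.exp (-(M * t)) * _
          ≤ Real.exp (-(M * t)) * (K / M * dist φ ψ * Real.exp (M * t)) := by
            gcongr
            refine hbound.trans ?_
            gcongr
            linarith [Real.exp_pos (M * τ)]
        _ = K / M * dist φ ψ * (Real.exp (-(M * t)) * Real.exp (M * t)) := by ring
        _ = K / M * dist φ ψ := by rw [← Real.exp_add]; simp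
  obtain ⟨φ, hφ⟩ : ∃ φ, Φ φ = φ := ⟨_, hΦ.fixedPoint_isFixedPt⟩
  have hφc : Continuous (Set.IccExtend hτT φ) := φ.continuous.Icc_extend'
  refine ⟨fun t => Real.exp (M * t) • Set.IccExtend hτT φ t, by fun_prop, fun t ht => ?_⟩
  have h := congrArg (fun ψ : C(Set.Icc τ T, E) => ψ ⟨t, ht⟩) hφ
  simp only [Φ, ContinuousMap.coe_mk] at h
  simp only [map_smul]
  rw [Set.IccExtend_of_mem hτT _ ht, ← h, smul_smul, ← Real.exp_add]
  simp

/-- Linear differential equations with continuous coefficients and prescribed terminal value. -/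
lemma exists_linear_ode_terminal {E : Type*} [NormedAddCommGroup E] [NormedSpace ℝ E]
    [CompleteSpace E] {τ T : ℝ} (hτT : τ ≤ T) {B : ℝ → E →L[ℝ] E}
    (hB : ContinuousOn B (Set.Icc τ T)) (c : E) :
    ∃ a : ℝ → E, (∀ t ∈ Set.Icc τ T, HasDerivWithinAt a (-(B t (a t))) (Set.Icc τ T) t) ∧
      a T = c := by
  let B' : ℝ → E →L[ℝ] E := fun t => B (Set.projIcc τ T hτT t)
  have hB' : Continuous B' := hB.comp_continuous
    (continuous_subtype_val.comp continuous_projIcc) fun t => (Set.projIcc τ T hτT t).2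
  have hBB' {t : ℝ} (ht : t ∈ Set.Icc τ T) : B' t = B t := by
    simp [B', Set.projIcc_of_mem hτT ht]
  obtain ⟨y, hyc, hy⟩ := exists_continuous_volterra hτT
    (A := fun s => B' (τ + T - s)) (by fun_prop) (b := fun _ => c) continuous_const
  refine ⟨fun t => y (τ + T - t), fun t ht => ?_, ?_⟩
  · have hrefl {s : ℝ} (hs : s ∈ Set.Icc τ T) : τ + T - s ∈ Set.Icc τ T :=
      ⟨by linarith [hs.2], by linarith [hs.1]⟩
    have hG : Continuous fun s => B' (τ + T - s) (y s) := by fun_prop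
    have h1 : HasDerivAt (fun r => c + ∫ s in τ..r, B' (τ + T - s) (y s))
        (B' (τ + T - (τ + T - t)) (y (τ + T - t))) (τ + T - t) :=
      (intervalIntegral.integral_hasDerivAt_right (hG.intervalIntegrable _ _)
        (hG.stronglyMeasurableAtFilter _ _) hG.continuousAt).const_add c
    have h2 := h1.scomp t ((hasDerivAt_id t).const_sub (τ + T))
    rw [sub_sub_cancel, hBB' ht, neg_one_smul] at h2
    exact h2.hasDerivWithinAt.congr (fun s hs => hy _ (hrefl hs)) (hy _ (hrefl ht))
  · simpa using hy τ ⟨le_rfl, hτT⟩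

/-! ### Integration by parts for absolutely continuous paths -/

/-- Integration by parts for absolutely continuous real functions, given as primitives. -/
lemma integral_parts_of_primitive {P Q p q : ℝ → ℝ} {α β : ℝ} (hαβ : α ≤ β)
    (hp : IntervalIntegrable p volume α β) (hq : IntervalIntegrable q volume α β)
    (hP : ∀ t ∈ Set.Icc α β, P t = P α + ∫ s in α..t, p s)
    (hQ : ∀ t ∈ Set.Icc α β, Q t = Q α + ∫ s in α..t, q s) :
    ∫ t in α..β, (p t * Q t + P t * q t) = P β * Q β - P α * Q α := by
  have hac {R r : ℝ → ℝ} (hr : IntervalIntegrable r volume α β) (c : ℝ) :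
      AbsolutelyContinuousOnInterval (fun t => c + ∫ s in α..t, r s) α β :=
    (LipschitzWith.const c).lipschitzOnWith.absolutelyContinuousOnInterval.add
      (hr.absolutelyContinuousOnInterval_intervalIntegral Set.left_mem_uIcc)
  have hderiv {r : ℝ → ℝ} (hr : IntervalIntegrable r volume α β) (c : ℝ) :
      ∀ᵐ t, t ∈ Set.Icc α β → deriv (fun t => c + ∫ s in α..t, r s) t = r t := by
    filter_upwards [hr.ae_hasDerivAt_integral] with t ht hmem
    rw [Set.uIcc_of_le hαβ] at ht
    exact ((ht hmem α ⟨le_rfl, hαβ⟩).const_add c).deriv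
  have h := (hac (R := P) hp (P α)).integral_deriv_mul_eq_sub (hac (R := Q) hq (Q α))
  rw [← hP β ⟨hαβ, le_rfl⟩, ← hQ β ⟨hαβ, le_rfl⟩] at h
  simp only [intervalIntegral.integral_same, add_zero] at h
  rw [← h]
  refine intervalIntegral.integral_congr_ae ?_
  filter_upwards [hderiv hp (P α), hderiv hq (Q α)] with t h1 h2 ht
  rw [Set.uIoc_of_le hαβ] at ht
  have ht' := Set.Ioc_subset_Icc_self ht
  rw [h1 ht', h2 ht', hP t ht', hQ t ht']

/-- Integration by parts for the inner product of absolutely continuous paths. -/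
lemma integral_inner_parts_of_primitive {d : ℕ} {P Q p q : ℝ → EuclideanSpace ℝ (Fin d)}
    {α β : ℝ} (hαβ : α ≤ β)
    (hp : IntervalIntegrable p volume α β) (hq : IntervalIntegrable q volume α β)
    (hP : ∀ t ∈ Set.Icc α β, P t = P α + ∫ s in α..t, p s)
    (hQ : ∀ t ∈ Set.Icc α β, Q t = Q α + ∫ s in α..t, q s) :
    ∫ t in α..β, (inner ℝ (p t) (Q t) + inner ℝ (P t) (q t)) =
      inner ℝ (P β) (Q β) - inner ℝ (P α) (Q α) := by
  have hcoord {R r : ℝ → EuclideanSpace ℝ (Fin d)} (hr : IntervalIntegrable r volume α β)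
      (hR : ∀ t ∈ Set.Icc α β, R t = R α + ∫ s in α..t, r s) (i : Fin d) :
      IntervalIntegrable (fun t => r t i) volume α β ∧
        ∀ t ∈ Set.Icc α β, R t i = R α i + ∫ s in α..t, r s i := by
    refine ⟨?_, fun t ht => ?_⟩
    · exact ⟨(EuclideanSpace.proj (𝕜 := ℝ) i).integrable_comp hr.1,
        (EuclideanSpace.proj (𝕜 := ℝ) i).integrable_comp hr.2⟩
    · have hr' : IntervalIntegrable r volume α t :=
        hr.mono_set (by rw [Set.uIcc_of_le ht.1, Set.uIcc_of_le hαβ]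
                        exact Set.Icc_subset_Icc_right ht.2)
      have := (EuclideanSpace.proj (𝕜 := ℝ) i).intervalIntegral_comp_comm hr'
      simp only [PiLp.proj_apply] at this
      rw [this, hR t ht]
      rfl
  have hcont {R r : ℝ → EuclideanSpace ℝ (Fin d)} (hr : IntervalIntegrable r volume α β)
      (hR : ∀ t ∈ Set.Icc α β, R t = R α + ∫ s in α..t, r s) (i : Fin d) :
      ContinuousOn (fun t => R t i) (Set.uIcc α β) := by
    have h1 : ContinuousOn (fun t => R α + ∫ s in α..t, r s) (Set.uIcc α β) :=
      continuousOn_const.add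
        (intervalIntegral.continuousOn_primitive_interval' hr Set.left_mem_uIcc)
    rw [Set.uIcc_of_le hαβ] at h1 ⊢
    exact (EuclideanSpace.proj (𝕜 := ℝ) i).continuous.comp_continuousOn
      (h1.congr fun t ht => hR t ht)
  have hinner (y z : EuclideanSpace ℝ (Fin d)) : inner ℝ y z = ∑ i, y i * z i := by
    simp [PiLp.inner_apply, mul_comm]
  simp only [hinner, ← Finset.sum_add_distrib, ← Finset.sum_sub_distrib]
  rw [intervalIntegral.integral_finsetSum]
  · refine Finset.sum_congr rfl fun i _ => ?_
    exact integral_parts_of_primitive hαβ (hcoord hp hP i).1 (hcoord hq hQ i).1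
      (hcoord hp hP i).2 (hcoord hq hQ i).2
  · intro i _
    exact ((hcoord hp hP i).1.mul_continuousOn (hcont hq hQ i)).add
      ((hcoord hq hQ i).1.continuousOn_mul (hcont hp hP i))

/-! ### From integral to pointwise minimization -/

/-- Localization: if the integral functional `z ↦ ∫ φ (z) + ⟪a, z⟫` attached to a continuous
integrand is no smaller at any bounded measurable `z` than at `w`, then `w t` minimizes the
integrand for almost every `t`. Only bounded competitors are needed although `w` is merely
integrable, because truncations of `w` converge by domination. -/
lemma ae_minimizes_of_integral_le {Ω E : Type*} [MeasurableSpace Ω] {μ : Measure Ω}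
    [IsFiniteMeasure μ] [NormedAddCommGroup E] [InnerProductSpace ℝ E]
    [SecondCountableTopology E] {φ : E → ℝ} (hφ : Continuous φ) {a w : Ω → E}
    (ha : AEStronglyMeasurable a μ) {C : ℝ} (haC : ∀ᵐ t ∂μ, ‖a t‖ ≤ C)
    (hw : Integrable w μ) (hφw : Integrable (fun t => φ (w t)) μ)
    (hmin : ∀ z : Ω → E, StronglyMeasurable z → (∃ N, ∀ t, ‖z t‖ ≤ N) →
      ∫ t, (φ (w t) + inner ℝ (a t) (w t)) ∂μ ≤ ∫ t, (φ (z t) + inner ℝ (a t) (z t)) ∂μ) :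
    ∀ᵐ t ∂μ, ∀ y, φ (w t) + inner ℝ (a t) (w t) ≤ φ y + inner ℝ (a t) y := by
  have hint {z : Ω → E} (hz : Integrable z μ) : Integrable (fun t => inner ℝ (a t) (z t)) μ := by
    refine (hz.norm.const_mul C).mono' (ha.inner hz.1) ?_
    filter_upwards [haC] with t ht
    exact (norm_inner_le_norm _ _).trans (by gcongr)
  have key (y : E) : ∀ᵐ t ∂μ, φ (w t) + inner ℝ (a t) (w t) ≤ φ y + inner ℝ (a t) y := by
    classical
    have hae : ∀ᵐ t ∂μ, a t = ha.mk a t ∧ w t = hw.1.mk w t := by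
      filter_upwards [ha.ae_eq_mk, hw.1.ae_eq_mk] with t h1 h2 using ⟨h1, h2⟩
    set a' := ha.mk a with ha'
    set w' := hw.1.mk w with hw'
    have ham : StronglyMeasurable a' := ha.stronglyMeasurable_mk
    have hwm : StronglyMeasurable w' := hw.1.stronglyMeasurable_mk
    set S : Set Ω := {t | φ y + inner ℝ (a' t) y < φ (w' t) + inner ℝ (a' t) (w' t)} with hS
    have hSm : MeasurableSet S :=
      ((stronglyMeasurable_const.add (ham.inner stronglyMeasurable_const)).measurableSet_lt
        ((hφ.comp_stronglyMeasurable hwm).add (ham.inner hwm)))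
    -- the competitor is `y` where `y` beats `w`, and a truncation of `w` elsewhere
    let z : ℕ → Ω → E := fun m => S.piecewise (fun _ => y)
      ({t | ‖w' t‖ ≤ m}.piecewise w' (fun _ => 0))
    have hzm (m : ℕ) : StronglyMeasurable (z m) :=
      stronglyMeasurable_const.piecewise hSm
        (hwm.piecewise (hwm.norm.measurableSet_le stronglyMeasurable_const)
          stronglyMeasurable_const)
    have hzcases (m : ℕ) (t : Ω) : z m t = y ∨ z m t = w' t ∨ z m t = 0 := by
      by_cases h1 : t ∈ S <;> by_cases h2 : ‖w' t‖ ≤ m <;> simp [z, h1, h2]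
    have hzb (m : ℕ) : ∃ N, ∀ t, ‖z m t‖ ≤ N := by
      refine ⟨max ‖y‖ m, fun t => ?_⟩
      by_cases h1 : t ∈ S <;> by_cases h2 : ‖w' t‖ ≤ m <;> simp [z, h1, h2]
    have hIw : Integrable (fun t => φ (w t) + inner ℝ (a t) (w t)) μ := hφw.add (hint hw)
    have hIy : Integrable (fun t => φ y + inner ℝ (a t) y) μ :=
      (integrable_const _).add (hint (integrable_const y))
    let G : Ω → ℝ := S.piecewise (fun t => φ y + inner ℝ (a t) y)
      (fun t => φ (w t) + inner ℝ (a t) (w t))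
    have hG : Integrable G μ := Integrable.piecewise hSm hIy.integrableOn hIw.integrableOn
    have hlim : Filter.Tendsto
        (fun m : ℕ => ∫ t, (φ (z m t) + inner ℝ (a t) (z m t)) ∂μ) Filter.atTop
        (nhds (∫ t, G t ∂μ)) := by
      refine tendsto_integral_of_dominated_convergence
        (fun t => |φ y + inner ℝ (a t) y| + |φ (w t) + inner ℝ (a t) (w t)| + |φ 0|)
        (fun m => ?_) ((hIy.abs.add hIw.abs).add (integrable_const _)) (fun m => ?_) ?_
      · exact (hφ.comp_stronglyMeasurable (hzm m)).aestronglyMeasurable.add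
          (ha.inner (hzm m).aestronglyMeasurable)
      · filter_upwards [hae] with t ht
        rw [Real.norm_eq_abs]
        have h1 := abs_nonneg (φ y + inner ℝ (a t) y)
        have h2 := abs_nonneg (φ (w t) + inner ℝ (a t) (w t))
        have h3 := abs_nonneg (φ 0)
        rcases hzcases m t with h | h | h
        · rw [h]; linarith
        · rw [h, ← ht.2]; linarith
        · rw [h, inner_zero_right, add_zero]; linarith
      · filter_upwards [hae] with t ht
        obtain ⟨m₀, hm₀⟩ := exists_nat_ge ‖w' t‖
        refine tendsto_const_nhds.congr' ?_
        filter_upwards [Filter.eventually_ge_atTop m₀] with m hm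
        have h2 : ‖w' t‖ ≤ m := hm₀.trans (by exact_mod_cast hm)
        by_cases h1 : t ∈ S <;> simp [z, G, h1, h2, ht.2]
    have hle : ∫ t, (φ (w t) + inner ℝ (a t) (w t)) ∂μ ≤ ∫ t, G t ∂μ :=
      ge_of_tendsto' hlim fun m => hmin (z m) (hzm m) (hzb m)
    have hGle : ∀ᵐ t ∂μ, 0 ≤ (φ (w t) + inner ℝ (a t) (w t)) - G t := by
      filter_upwards [hae] with t ht
      by_cases h1 : t ∈ S
      · have h2 : φ y + inner ℝ (a' t) y < φ (w' t) + inner ℝ (a' t) (w' t) := h1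
        simp only [G, Set.piecewise_eq_of_mem _ _ _ h1, ht.1, ht.2]
        linarith
      · simp [G, h1]
    have hzero : ∫ t, ((φ (w t) + inner ℝ (a t) (w t)) - G t) ∂μ = 0 := by
      refine le_antisymm ?_ (integral_nonneg_of_ae hGle)
      rw [integral_sub hIw hG]
      linarith
    rw [integral_eq_zero_iff_of_nonneg_ae hGle (hIw.sub hG)] at hzero
    filter_upwards [hae, hzero] with t ht h0
    by_contra! hlt
    have h1 : t ∈ S := by
      rw [ht.1, ht.2] at hlt
      exact hlt
    simp only [G, Set.piecewise_eq_of_mem _ _ _ h1, Pi.zero_apply] at h0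
    linarith
  filter_upwards [ae_all_iff.2 fun n => key (TopologicalSpace.denseSeq E n)] with t ht y
  have hclosed : IsClosed {y | φ (w t) + inner ℝ (a t) (w t) ≤ φ y + inner ℝ (a t) y} :=
    isClosed_le continuous_const (by fun_prop)
  exact (TopologicalSpace.denseRange_denseSeq E).induction_on y hclosed ht

/-! ### Minimizing the Hamiltonian at a fixed time -/

/-- A strictly convex function that is monotone on `[0, ∞)` is minimized there only at `0`. -/
lemma eq_zero_of_le_apply_zero {f : ℝ → ℝ} (hf_convex : StrictConvexOn ℝ (Set.Ici 0) f)
    (hf_mono : MonotoneOn f (Set.Ici 0)) {r : ℝ} (hr : 0 ≤ r) (h : f r ≤ f 0) : r = 0 := by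
  by_contra hne
  have hpos : 0 < r := lt_of_le_of_ne hr (Ne.symm hne)
  have h1 := hf_convex.2 (Set.self_mem_Ici (a := (0 : ℝ))) hr hpos.ne
    (by norm_num : (0 : ℝ) < 1 / 2) (by norm_num : (0 : ℝ) < 1 / 2) (by norm_num)
  simp only [smul_eq_mul] at h1
  have h2 := hf_mono (Set.self_mem_Ici (a := (0 : ℝ)))
    (show 1 / 2 * 0 + 1 / 2 * r ∈ Set.Ici (0 : ℝ) by simp; linarith) (by linarith)
  linarith

/-- First-order conditions at a minimizer `r` of `s ↦ f s - c s` on `[0, ∞)`. -/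
lemma costDeriv_of_minimizes {f : ℝ → ℝ} (hf : DifferentiableOn ℝ f (Set.Ici 0)) {r c : ℝ}
    (hr : 0 ≤ r) (hmin : ∀ s, 0 ≤ s → f r - c * r ≤ f s - c * s) :
    c ≤ costDeriv f r ∧ (0 < r → costDeriv f r = c) := by
  have hd : HasDerivWithinAt (fun s => f s - c * s) (costDeriv f r - c) (Set.Ici 0) r := by
    have h := (hf r hr).hasDerivWithinAt.sub ((hasDerivWithinAt_id r (Set.Ici 0)).const_mul c)
    rw [mul_one] at h
    exact h
  have hm : IsLocalMinOn (fun s => f s - c * s) (Set.Ici 0) r :=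
    IsMinOn.localize fun s hs => hmin s hs
  have hcone : (1 : ℝ) ∈ posTangentConeAt (Set.Ici 0) r :=
    mem_posTangentConeAt_of_segment_subset
      ((convex_Ici 0).segment_subset hr (show (0 : ℝ) ≤ r + 1 by linarith))
  constructor
  · have := hm.hasFDerivWithinAt_nonneg hd.hasFDerivWithinAt hcone
    simp at this
    linarith
  · intro hpos
    have hnhds : Set.Ici (0 : ℝ) ∈ nhds r := Ici_mem_nhds hpos
    have := (hm.isLocalMin hnhds).hasDerivAt_eq_zero (hd.hasDerivAt hnhds)
    linarith

/-- The first-order conditions at `r` determine `costDerivInv f c`, including the case where `c` is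
below `f' 0` and the inverse takes its default value `0`. -/
lemma costDerivInv_eq {f : ℝ → ℝ} (hf : StrictMonoOn (costDeriv f) (Set.Ici 0)) {r c : ℝ}
    (hr : 0 ≤ r) (h1 : c ≤ costDeriv f r) (h2 : 0 < r → costDeriv f r = c) :
    costDerivInv f c = r := by
  unfold costDerivInv
  split_ifs with h
  · obtain ⟨h3, h4⟩ := h.choose_spec
    generalize h.choose = s at h3 h4
    rcases hr.eq_or_lt with rfl | hpos
    · by_contra hne
      have := hf (Set.self_mem_Ici (a := (0 : ℝ))) h3 (lt_of_le_of_ne h3 (Ne.symm hne))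
      linarith
    · exact hf.injOn h3 hr (h4.trans (h2 hpos).symm)
  · rcases hr.eq_or_lt with rfl | hpos
    · rfl
    · exact absurd ⟨r, hr, h2 hpos⟩ h

/-- The pointwise minimizer of the Hamiltonian `y ↦ f ‖y‖ + ⟪a, y⟫` is the control law: comparing
`w` with `-(r / ‖a‖) a` forces equality in Cauchy-Schwarz and reduces to the radial problem
`min (f r - ‖a‖ r)`. -/
lemma eq_controlLaw_of_minimizes {d : ℕ} {f : ℝ → ℝ}
    (hf : DifferentiableOn ℝ f (Set.Ici 0)) (hf_convex : StrictConvexOn ℝ (Set.Ici 0) f)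
    (hf_mono : MonotoneOn f (Set.Ici 0)) {a w : EuclideanSpace ℝ (Fin d)}
    (hmin : ∀ y, f ‖w‖ + inner ℝ a w ≤ f ‖y‖ + inner ℝ a y) :
    (costDeriv f 0 ≤ ‖a‖ → ∃ r : ℝ, 0 ≤ r ∧ costDeriv f r = ‖a‖) ∧ w = controlLaw f a := by
  have hdir : ‖w‖ • a + ‖a‖ • w = 0 ∧ ∀ s, 0 ≤ s → f ‖w‖ - ‖a‖ * ‖w‖ ≤ f s - ‖a‖ * s := by
    by_cases ha : a = 0
    · have hw : w = 0 := by
        have := hmin 0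
        simp only [ha, inner_zero_left, add_zero, norm_zero] at this
        exact norm_eq_zero.1 (eq_zero_of_le_apply_zero hf_convex hf_mono (norm_nonneg w) this)
      refine ⟨by simp [ha, hw], fun s hs => ?_⟩
      simpa [ha, hw] using hf_mono (Set.self_mem_Ici (a := (0 : ℝ))) hs hs
    · have ha' : 0 < ‖a‖ := norm_pos_iff.2 ha
      have hrad (s : ℝ) (hs : 0 ≤ s) : f ‖w‖ + inner ℝ a w ≤ f s - ‖a‖ * s := by
        have h := hmin (-((s / ‖a‖) • a))
        rw [norm_neg, norm_smul, norm_div, norm_norm, Real.norm_of_nonneg hs, inner_neg_right,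
          inner_smul_right, real_inner_self_eq_norm_sq, div_mul_cancel₀ _ ha'.ne'] at h
        have : s / ‖a‖ * ‖a‖ ^ 2 = ‖a‖ * s := by field_simp
        linarith
      have hin : inner ℝ a w ≤ -(‖a‖ * ‖w‖) := by linarith [hrad ‖w‖ (norm_nonneg w)]
      refine ⟨?_, fun s hs => ?_⟩
      · rw [← norm_eq_zero, ← sq_eq_zero_iff]
        refine le_antisymm ?_ (sq_nonneg _)
        rw [norm_add_sq_real, norm_smul, norm_smul, norm_norm, norm_norm, inner_smul_left,
          inner_smul_right]
        simp only [conj_trivial]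
        have := mul_le_mul_of_nonneg_left hin
          (mul_nonneg (norm_nonneg w) (norm_nonneg a))
        nlinarith
      · have := neg_le_of_abs_le (abs_real_inner_le_norm a w)
        linarith [hrad s hs]
  obtain ⟨hdir, hrad⟩ := hdir
  obtain ⟨h1, h2⟩ := costDeriv_of_minimizes hf (norm_nonneg w) hrad
  have hstrict : StrictMonoOn (costDeriv f) (Set.Ici 0) := hf_convex.strictMonoOn_derivWithin hf
  refine ⟨fun h0 => ⟨‖w‖, norm_nonneg w, ?_⟩, ?_⟩
  · rcases (norm_nonneg w).eq_or_lt with hw | hw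
    · rw [← hw] at h1 ⊢
      exact le_antisymm h0 h1
    · exact h2 hw
  · rw [controlLaw, costDerivInv_eq hstrict (norm_nonneg w) h1 h2]
    by_cases ha : a = 0
    · have := eq_zero_of_le_apply_zero hf_convex hf_mono (norm_nonneg w)
        (by simpa [ha] using hrad 0 le_rfl)
      simp [ha, norm_eq_zero.1 this]
    · have ha' : ‖a‖ ≠ 0 := norm_ne_zero_iff.2 ha
      have h3 : ‖a‖ • w = -(‖w‖ • a) := eq_neg_of_add_eq_zero_right hdir
      rw [div_eq_inv_mul, mul_smul, ← smul_neg, ← h3, smul_smul, inv_mul_cancel₀ ha', one_smul]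

lemma costDeriv_of_eq_rpow {f : ℝ → ℝ} {p lam : ℝ} (hp : 1 < p) (hlam : 0 < lam)
    (hf : ∀ r : ℝ, 0 ≤ r → f r = r ^ p / (p * lam)) {r : ℝ} (hr : 0 ≤ r) :
    costDeriv f r = r ^ (p - 1) / lam := by
  have h1 : HasDerivWithinAt (fun r : ℝ => r ^ p / (p * lam)) (p * r ^ (p - 1) / (p * lam))
      (Set.Ici 0) r :=
    ((Real.hasDerivAt_rpow_const (Or.inr hp.le)).div_const _).hasDerivWithinAt
  have h2 : HasDerivWithinAt f (p * r ^ (p - 1) / (p * lam)) (Set.Ici 0) r :=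
    h1.congr (fun s hs => hf s hs) (hf r hr)
  rw [costDeriv, h2.derivWithin (uniqueDiffOn_Ici 0 r hr)]
  field_simp

lemma costDerivInv_of_eq_rpow {f : ℝ → ℝ} {p lam : ℝ} (hp : 1 < p) (hlam : 0 < lam)
    (hf : ∀ r : ℝ, 0 ≤ r → f r = r ^ p / (p * lam)) {y : ℝ} (hy : 0 ≤ y) :
    costDerivInv f y = (lam * y) ^ (1 / (p - 1)) := by
  have hp' : p - 1 ≠ 0 := by linarith
  have hex : ∃ r : ℝ, 0 ≤ r ∧ costDeriv f r = y := by
    refine ⟨(lam * y) ^ (1 / (p - 1)), by positivity, ?_⟩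
    rw [costDeriv_of_eq_rpow hp hlam hf (by positivity), ← Real.rpow_mul (by positivity),
      one_div_mul_cancel hp', Real.rpow_one]
    field_simp
  rw [costDerivInv, dif_pos hex]
  obtain ⟨h1, h2⟩ := hex.choose_spec
  generalize hex.choose = r at h1 h2
  rw [costDeriv_of_eq_rpow hp hlam hf h1, div_eq_iff hlam.ne'] at h2
  rw [mul_comm lam, ← h2, ← Real.rpow_mul h1, mul_one_div_cancel hp', Real.rpow_one]

lemma controlLaw_of_eq_rpow {d : ℕ} {f : ℝ → ℝ} {p lam : ℝ} (hp : 1 < p) (hlam : 0 < lam)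
    (hf : ∀ r : ℝ, 0 ≤ r → f r = r ^ p / (p * lam)) (a : EuclideanSpace ℝ (Fin d)) :
    controlLaw f a = -((lam ^ (1 / (p - 1)) * ‖a‖ ^ ((2 - p) / (p - 1))) • a) := by
  by_cases ha : a = 0
  · simp [controlLaw, ha]
  · have ha' : 0 < ‖a‖ := norm_pos_iff.2 ha
    have hp' : p - 1 ≠ 0 := by linarith
    rw [controlLaw, costDerivInv_of_eq_rpow hp hlam hf (norm_nonneg a),
      Real.mul_rpow hlam.le ha'.le, mul_div_assoc]
    congr 3
    rw [← Real.rpow_sub_one ha'.ne']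
    congr 1
    field_simp
    ring

/-! ### First variation of an optimal pair -/

section Variation

variable {d : ℕ} {τ : ℝ} {f : ℝ → ℝ}
  {v : EuclideanSpace ℝ (Fin d) → ℝ → EuclideanSpace ℝ (Fin d)}
  {g : EuclideanSpace ℝ (Fin d) → ℝ} {x : EuclideanSpace ℝ (Fin d)}
  {X Y ξ : ℝ → EuclideanSpace ℝ (Fin d)}
  {u : EuclideanSpace ℝ (Fin d) → ℝ → EuclideanSpace ℝ (Fin d)}

lemma continuous_comp_norm {E : Type*} [NormedAddCommGroup E]
    (hf : ContinuousOn f (Set.Ici 0)) : Continuous fun y : E => f ‖y‖ :=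
  hf.comp_continuous continuous_norm norm_nonneg

lemma comp_norm_convexCombo_le {E : Type*} [NormedAddCommGroup E] [NormedSpace ℝ E]
    (hf_convex : StrictConvexOn ℝ (Set.Ici 0) f) (hf_mono : MonotoneOn f (Set.Ici 0))
    {ε : ℝ} (h0 : 0 ≤ ε) (h1 : ε ≤ 1) (y z : E) :
    f ‖(1 - ε) • y + ε • z‖ ≤ (1 - ε) * f ‖y‖ + ε * f ‖z‖ := by
  have h1' : 0 ≤ 1 - ε := by linarith
  have hle : ‖(1 - ε) • y + ε • z‖ ≤ (1 - ε) * ‖y‖ + ε * ‖z‖ := by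
    refine (norm_add_le _ _).trans_eq ?_
    rw [norm_smul, norm_smul, Real.norm_of_nonneg h0, Real.norm_of_nonneg h1']
  refine (hf_mono (norm_nonneg _) ?_ hle).trans ?_
  · show 0 ≤ (1 - ε) * ‖y‖ + ε * ‖z‖
    positivity
  · exact hf_convex.convexOn.2 (norm_nonneg y) (norm_nonneg z) h1' h0 (by ring)

lemma integrable_comp_norm_of_bounded {Ω E : Type*} [MeasurableSpace Ω] {μ : Measure Ω}
    [IsFiniteMeasure μ] [NormedAddCommGroup E] (hf : ContinuousOn f (Set.Ici 0))
    (hf_mono : MonotoneOn f (Set.Ici 0)) {z : Ω → E} (hz : AEStronglyMeasurable z μ) {N : ℝ}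
    (hN : ∀ᵐ t ∂μ, ‖z t‖ ≤ N) : Integrable (fun t => f ‖z t‖) μ := by
  refine Integrable.of_bound ((continuous_comp_norm hf).comp_aestronglyMeasurable hz)
    (|f 0| + |f N|) ?_
  filter_upwards [hN] with t ht
  have h1 := hf_mono (Set.self_mem_Ici (a := (0 : ℝ))) (norm_nonneg (z t)) (norm_nonneg (z t))
  have h2 := hf_mono (norm_nonneg (z t)) ((norm_nonneg (z t)).trans ht) ht
  rw [Real.norm_eq_abs]
  exact (abs_le_max_abs_abs h1 h2).trans (max_le_add_of_nonneg (abs_nonneg _) (abs_nonneg _))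

/-- Every absolutely continuous path `Y` from `x` is the trajectory of an open-loop control, namely
of its velocity minus the drift. Competitors can thus be prescribed through their paths, without
solving the controlled equation. -/
lemma isAdmissiblePair_of_path {c : ℝ → EuclideanSpace ℝ (Fin d)}
    (hv_cont : ContinuousOn (fun z : EuclideanSpace ℝ (Fin d) × ℝ => v z.1 z.2)
      (Set.univ ×ˢ Set.Icc τ 1))
    (hY : ContinuousOn Y (Set.Icc τ 1)) (hc : IntegrableOn c (Set.Icc τ 1))
    (hYc : ∀ t ∈ Set.Icc τ 1, Y t = x + ∫ s in τ..t, c s)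
    (hcost : IntegrableOn (fun t => f ‖c t - v (Y t) t‖) (Set.Icc τ 1)) :
    IsAdmissiblePair f v τ x Y (fun _ t => c t - v (Y t) t) where
  control_integrable := hc.sub <| ContinuousOn.integrableOn_Icc <|
    hv_cont.comp (hY.prodMk continuousOn_id) fun t ht => ⟨Set.mem_univ _, ht⟩
  cost_integrable := hcost
  continuousOn := hY
  dynamics := by simpa using hYc

/-- The rescaled linearization error of `v` along `X` in the direction `ξ`: it is continuous in
time, bounded uniformly in `ε`, and tends to `0` pointwise as `ε → 0⁺`. -/
lemma linearization_error
    (hv_cont : ContinuousOn (fun z : EuclideanSpace ℝ (Fin d) × ℝ => v z.1 z.2)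
      (Set.univ ×ˢ Set.Icc τ 1))
    (hv_diff : ∀ t ∈ Set.Icc τ 1, Differentiable ℝ (fun y => v y t))
    (hv_deriv : ContinuousOn
      (fun z : EuclideanSpace ℝ (Fin d) × ℝ => fderiv ℝ (fun y => v y z.2) z.1)
      (Set.univ ×ˢ Set.Icc τ 1))
    (hX : ContinuousOn X (Set.Icc τ 1)) (hξ : ContinuousOn ξ (Set.Icc τ 1)) :
    let ρ : ℝ → ℝ → EuclideanSpace ℝ (Fin d) := fun ε t =>
      ε⁻¹ • (v (X t + ε • ξ t) t - v (X t) t) - fderiv ℝ (fun y => v y t) (X t) (ξ t)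
    (∀ ε, ContinuousOn (ρ ε) (Set.Icc τ 1)) ∧
    (∃ C, ∀ ε ∈ Set.Ioc (0 : ℝ) 1, ∀ t ∈ Set.Icc τ 1, ‖ρ ε t‖ ≤ C) ∧
    ∀ t ∈ Set.Icc τ 1, Filter.Tendsto (fun ε => ρ ε t) (nhdsWithin 0 (Set.Ioi 0)) (nhds 0) := by
  intro ρ
  have hvalong {Y : ℝ → EuclideanSpace ℝ (Fin d)} (hY : ContinuousOn Y (Set.Icc τ 1)) :
      ContinuousOn (fun t => v (Y t) t) (Set.Icc τ 1) :=
    hv_cont.comp (hY.prodMk continuousOn_id) fun t ht => ⟨Set.mem_univ _, ht⟩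
  have hA : ContinuousOn (fun t => fderiv ℝ (fun y => v y t) (X t)) (Set.Icc τ 1) :=
    hv_deriv.comp (hX.prodMk continuousOn_id) fun t ht => ⟨Set.mem_univ _, ht⟩
  refine ⟨fun ε => ?_, ?_, fun t ht => ?_⟩
  · exact (((hvalong (hX.add (hξ.const_smul ε))).sub (hvalong hX)).const_smul ε⁻¹).sub
      (hA.clm_apply hξ)
  · obtain ⟨RX, hRX⟩ := isCompact_Icc.exists_bound_of_continuousOn hX
    obtain ⟨Rξ, hRξ⟩ := isCompact_Icc.exists_bound_of_continuousOn hξ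
    obtain ⟨K, hK⟩ := ((isCompact_closedBall (0 : EuclideanSpace ℝ (Fin d)) (RX + Rξ)).prod
      (isCompact_Icc (a := τ) (b := 1))).exists_bound_of_continuousOn
      (hv_deriv.mono (Set.prod_mono (Set.subset_univ _) le_rfl))
    refine ⟨K * Rξ + K * Rξ, fun ε hε t ht => ?_⟩
    have hRξ0 : 0 ≤ Rξ := (norm_nonneg _).trans (hRξ t ht)
    have hX0 : X t ∈ Metric.closedBall (0 : EuclideanSpace ℝ (Fin d)) (RX + Rξ) := by
      rw [mem_closedBall_zero_iff]
      linarith [hRX t ht]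
    have hXε : X t + ε • ξ t ∈ Metric.closedBall (0 : EuclideanSpace ℝ (Fin d)) (RX + Rξ) := by
      rw [mem_closedBall_zero_iff]
      refine (norm_add_le _ _).trans (add_le_add (hRX t ht) ?_)
      rw [norm_smul, Real.norm_of_nonneg hε.1.le]
      exact (mul_le_of_le_one_left (norm_nonneg _) hε.2).trans (hRξ t ht)
    have hlip := (convex_closedBall (0 : EuclideanSpace ℝ (Fin d)) (RX + Rξ)
      ).norm_image_sub_le_of_norm_fderiv_le (𝕜 := ℝ) (f := fun y => v y t) (C := K)
      (fun y _ => (hv_diff t ht) y) (fun y hy => hK (y, t) ⟨hy, ht⟩) hX0 hXε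
    have hK0 : 0 ≤ K := (norm_nonneg _).trans (hK (X t, t) ⟨hX0, ht⟩)
    refine (norm_sub_le _ _).trans (add_le_add ?_ ?_)
    · rw [norm_smul, norm_inv, Real.norm_of_nonneg hε.1.le, inv_mul_le_iff₀ hε.1]
      refine hlip.trans ?_
      rw [add_sub_cancel_left, norm_smul, Real.norm_of_nonneg hε.1.le]
      have := mul_le_mul_of_nonneg_left (hRξ t ht) (mul_nonneg hε.1.le hK0)
      linarith
    · exact ContinuousLinearMap.le_of_opNorm_le_of_le _ (hK (X t, t) ⟨hX0, ht⟩) (hRξ t ht)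
  · have h := ((hv_diff t ht) (X t)).hasFDerivAt.hasLineDerivAt (ξ t)
    have h' := h.tendsto_slope_zero_right.sub_const (fderiv ℝ (fun y => v y t) (X t) (ξ t))
    rwa [sub_self] at h'

/-- If the path `Y` is driven by a convex combination `(1 - ε) u + ε ζ` with `ζ` bounded, then
comparison with `Y` bounds the optimal running cost by that of `ζ` plus a difference quotient of
the terminal cost. -/
lemma integral_cost_le_of_convexCombo (hτ : τ ≤ 1)
    (hf : ContinuousOn f (Set.Ici 0))
    (hf_convex : StrictConvexOn ℝ (Set.Ici 0) f) (hf_mono : MonotoneOn f (Set.Ici 0))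
    (hv_cont : ContinuousOn (fun z : EuclideanSpace ℝ (Fin d) × ℝ => v z.1 z.2)
      (Set.univ ×ˢ Set.Icc τ 1))
    (hopt : IsOptimalPair f g v τ x X u)
    {ε : ℝ} (hε : ε ∈ Set.Ioc (0 : ℝ) 1) {c ζ : ℝ → EuclideanSpace ℝ (Fin d)}
    (hY : ContinuousOn Y (Set.Icc τ 1)) (hcI : IntegrableOn c (Set.Icc τ 1))
    (hYc : ∀ t ∈ Set.Icc τ 1, Y t = x + ∫ s in τ..t, c s)
    (hζ : AEStronglyMeasurable ζ (volume.restrict (Set.Icc τ 1))) {N : ℝ}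
    (hN : ∀ᵐ t ∂(volume.restrict (Set.Icc τ 1)), ‖ζ t‖ ≤ N)
    (hcζ : ∀ t, c t - v (Y t) t = (1 - ε) • u (X t) t + ε • ζ t) :
    ∫ t in Set.Icc τ 1, f ‖u (X t) t‖ ≤
      (∫ t in Set.Icc τ 1, f ‖ζ t‖) + ε⁻¹ • (g (Y 1) - g (X 1)) := by
  obtain ⟨hadm, hbest⟩ := hopt
  have hIcc {F : ℝ → ℝ} : ∫ t in τ..1, F t = ∫ t in Set.Icc τ 1, F t := by
    rw [intervalIntegral.integral_of_le hτ, integral_Icc_eq_integral_Ioc]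
  have hζI : IntegrableOn (fun t => f ‖ζ t‖) (Set.Icc τ 1) :=
    integrable_comp_norm_of_bounded hf hf_mono hζ hN
  have hle (t : ℝ) : f ‖c t - v (Y t) t‖ ≤ (1 - ε) * f ‖u (X t) t‖ + ε * f ‖ζ t‖ := by
    rw [hcζ]
    exact comp_norm_convexCombo_le hf_convex hf_mono hε.1.le hε.2 _ _
  have hupI : IntegrableOn (fun t => (1 - ε) * f ‖u (X t) t‖ + ε * f ‖ζ t‖) (Set.Icc τ 1) :=
    (hadm.cost_integrable.const_mul _).add (hζI.const_mul _)
  have hm : AEStronglyMeasurable (fun t => c t - v (Y t) t) (volume.restrict (Set.Icc τ 1)) := by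
    simp only [hcζ]
    exact (hadm.control_integrable.1.const_smul (1 - ε)).add (hζ.const_smul ε)
  have hcost : IntegrableOn (fun t => f ‖c t - v (Y t) t‖) (Set.Icc τ 1) :=
    integrable_of_le_of_le (g₁ := fun _ => f 0)
      ((continuous_comp_norm hf).comp_aestronglyMeasurable hm)
      (ae_of_all _ fun t => hf_mono (Set.self_mem_Ici (a := (0 : ℝ))) (norm_nonneg _)
        (norm_nonneg _)) (ae_of_all _ hle) (integrable_const _) hupI
  have hbest' := hbest _ _ (isAdmissiblePair_of_path hv_cont hY hcI hYc hcost)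
  simp only [controlCost, hIcc] at hbest'
  have hint := integral_mono hcost hupI hle
  rw [integral_add (hadm.cost_integrable.const_mul _) (hζI.const_mul _),
    integral_const_mul, integral_const_mul] at hint
  rw [← mul_le_mul_iff_right₀ hε.1, mul_add, smul_eq_mul, mul_inv_cancel_left₀ hε.1.ne']
  linarith

/-- First-order optimality: for a bounded `z`, let `ξ` be the linearized response of the trajectory
to the control direction `z - u`. The path `X + ε ξ` is driven exactly by
`(1 - ε) u + ε (z - ρ_ε)`, where `ρ_ε` is the rescaled linearization error; convexity of the running
cost bounds its cost without any growth assumption on `f`, and `ε → 0⁺` gives the inequality. -/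
lemma integral_cost_le_of_linearized (hτ : τ ≤ 1)
    (hf : ContinuousOn f (Set.Ici 0))
    (hf_convex : StrictConvexOn ℝ (Set.Ici 0) f) (hf_mono : MonotoneOn f (Set.Ici 0))
    (hv_cont : ContinuousOn (fun z : EuclideanSpace ℝ (Fin d) × ℝ => v z.1 z.2)
      (Set.univ ×ˢ Set.Icc τ 1))
    (hv_diff : ∀ t ∈ Set.Icc τ 1, Differentiable ℝ (fun y => v y t))
    (hv_deriv : ContinuousOn
      (fun z : EuclideanSpace ℝ (Fin d) × ℝ => fderiv ℝ (fun y => v y z.2) z.1)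
      (Set.univ ×ˢ Set.Icc τ 1))
    (hg : Differentiable ℝ g) (hopt : IsOptimalPair f g v τ x X u)
    {z : ℝ → EuclideanSpace ℝ (Fin d)} (hz : StronglyMeasurable z) {N : ℝ}
    (hN : ∀ t, ‖z t‖ ≤ N) (hξ : ContinuousOn ξ (Set.Icc τ 1))
    (hξeq : ∀ t ∈ Set.Icc τ 1, ξ t =
      ∫ s in τ..t, (fderiv ℝ (fun y => v y s) (X s) (ξ s) + (z s - u (X s) s))) :
    ∫ t in Set.Icc τ 1, f ‖u (X t) t‖ ≤
      (∫ t in Set.Icc τ 1, f ‖z t‖) + inner ℝ (gradient g (X 1)) (ξ 1) := by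
  have hadm := hopt.1
  have hX := hadm.continuousOn
  obtain ⟨hρc, ⟨C, hC⟩, hρlim⟩ := linearization_error hv_cont hv_diff hv_deriv hX hξ
  set ρ : ℝ → ℝ → EuclideanSpace ℝ (Fin d) := fun ε t =>
    ε⁻¹ • (v (X t + ε • ξ t) t - v (X t) t) - fderiv ℝ (fun y => v y t) (X t) (ξ t) with hρ
  set w : ℝ → EuclideanSpace ℝ (Fin d) := fun t => u (X t) t with hw
  have hzI : IntegrableOn z (Set.Icc τ 1) :=
    Integrable.of_bound hz.aestronglyMeasurable N (ae_of_all _ hN)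
  have hwI : IntegrableOn w (Set.Icc τ 1) := hadm.control_integrable
  have hvI : IntegrableOn (fun t => v (X t) t) (Set.Icc τ 1) := ContinuousOn.integrableOn_Icc <|
    hv_cont.comp (hX.prodMk continuousOn_id) fun t ht => ⟨Set.mem_univ _, ht⟩
  have hAI : IntegrableOn (fun t => fderiv ℝ (fun y => v y t) (X t) (ξ t)) (Set.Icc τ 1) :=
    ContinuousOn.integrableOn_Icc <| ContinuousOn.clm_apply
      (hv_deriv.comp (hX.prodMk continuousOn_id) fun t ht => ⟨Set.mem_univ _, ht⟩) hξ
  have hzρm (ε : ℝ) : AEStronglyMeasurable (fun t => z t - ρ ε t)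
      (volume.restrict (Set.Icc τ 1)) :=
    hz.aestronglyMeasurable.sub ((hρc ε).aestronglyMeasurable measurableSet_Icc)
  have hzρb {ε : ℝ} (hε : ε ∈ Set.Ioc (0 : ℝ) 1) :
      ∀ᵐ t ∂(volume.restrict (Set.Icc τ 1)), ‖z t - ρ ε t‖ ≤ N + C := by
    filter_upwards [ae_restrict_mem measurableSet_Icc] with t ht
    exact (norm_sub_le _ _).trans (add_le_add (hN t) (hC ε hε t ht))
  have hstep {ε : ℝ} (hε : ε ∈ Set.Ioc (0 : ℝ) 1) :
      ∫ t in Set.Icc τ 1, f ‖w t‖ ≤ (∫ t in Set.Icc τ 1, f ‖z t - ρ ε t‖) +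
        ε⁻¹ • (g (X 1 + ε • ξ 1) - g (X 1)) := by
    -- the velocity of the path `X + ε ξ`
    let c : ℝ → EuclideanSpace ℝ (Fin d) := fun t => (v (X t) t + w t) +
      ε • (fderiv ℝ (fun y => v y t) (X t) (ξ t) + (z t - w t))
    have hcI : IntegrableOn c (Set.Icc τ 1) :=
      (hvI.add hwI).add ((hAI.add (hzI.sub hwI)).smul ε)
    have hcu (t : ℝ) : c t - v (X t + ε • ξ t) t = (1 - ε) • w t + ε • (z t - ρ ε t) := by
      simp only [c, hρ, smul_sub, smul_add, smul_smul, mul_inv_cancel₀ hε.1.ne', one_smul,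
        sub_smul]
      abel
    have hpath : ∀ t ∈ Set.Icc τ 1, X t + ε • ξ t = x + ∫ s in τ..t, c s := by
      intro t ht
      have hsub {F : ℝ → EuclideanSpace ℝ (Fin d)} (hF : IntegrableOn F (Set.Icc τ 1)) :
          IntervalIntegrable F volume τ t :=
        (intervalIntegrable_iff_integrableOn_Icc_of_le ht.1).2
          (hF.mono_set (Set.Icc_subset_Icc_right ht.2))
      have hdrift : IntervalIntegrable (fun s => v (X s) s + w s) volume τ t := hsub (hvI.add hwI)
      have hpert : IntervalIntegrable (fun s => ε •
          (fderiv ℝ (fun y => v y s) (X s) (ξ s) + (z s - w s))) volume τ t :=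
        hsub ((hAI.add (hzI.sub hwI)).smul ε)
      rw [hadm.dynamics t ht, hξeq t ht, ← intervalIntegral.integral_smul, add_assoc,
        ← intervalIntegral.integral_add hdrift hpert]
    exact integral_cost_le_of_convexCombo hτ hf hf_convex hf_mono hv_cont hopt hε
      (hX.add (hξ.const_smul ε)) hcI hpath (hzρm ε) (hzρb hε) hcu
  have hεev : ∀ᶠ ε in nhdsWithin (0 : ℝ) (Set.Ioi 0), ε ∈ Set.Ioc (0 : ℝ) 1 :=
    Ioc_mem_nhdsGT one_pos
  have hlim1 : Filter.Tendsto (fun ε => ∫ t in Set.Icc τ 1, f ‖z t - ρ ε t‖)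
      (nhdsWithin 0 (Set.Ioi 0)) (nhds (∫ t in Set.Icc τ 1, f ‖z t‖)) := by
    refine tendsto_integral_filter_of_dominated_convergence (fun _ => |f 0| + |f (N + C)|)
      (Filter.Eventually.of_forall fun ε =>
        (continuous_comp_norm hf).comp_aestronglyMeasurable (hzρm ε)) ?_ (integrable_const _) ?_
    · filter_upwards [hεev] with ε hε
      filter_upwards [hzρb hε] with t ht
      have h1 := hf_mono (Set.self_mem_Ici (a := (0 : ℝ))) (norm_nonneg (z t - ρ ε t))
        (norm_nonneg _)
      have h2 := hf_mono (norm_nonneg (z t - ρ ε t)) ((norm_nonneg _).trans ht) ht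
      rw [Real.norm_eq_abs]
      exact (abs_le_max_abs_abs h1 h2).trans
        (max_le_add_of_nonneg (abs_nonneg _) (abs_nonneg _))
    · filter_upwards [ae_restrict_mem measurableSet_Icc] with t ht
      have h := ((hρlim t ht).const_sub (z t))
      rw [sub_zero] at h
      exact ((continuous_comp_norm hf).tendsto (z t)).comp h
  have hlim2 : Filter.Tendsto (fun ε : ℝ => ε⁻¹ • (g (X 1 + ε • ξ 1) - g (X 1)))
      (nhdsWithin 0 (Set.Ioi 0)) (nhds (inner ℝ (gradient g (X 1)) (ξ 1))) := by
    have h := ((hg (X 1)).hasFDerivAt.hasLineDerivAt (ξ 1)).tendsto_slope_zero_right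
    rwa [gradient, InnerProductSpace.toDual_symm_apply]
  exact ge_of_tendsto (hlim1.add hlim2) (hεev.mono fun ε hε => hstep hε)

/-- The pointwise form of Pontryagin's principle: along an optimal pair, the control minimizes the
Hamiltonian `y ↦ f ‖y‖ + ⟪a t, y⟫` at almost every time. -/
lemma ae_minimizes_hamiltonian (hτ : τ ≤ 1)
    (hf : ContinuousOn f (Set.Ici 0))
    (hf_convex : StrictConvexOn ℝ (Set.Ici 0) f) (hf_mono : MonotoneOn f (Set.Ici 0))
    (hv_cont : ContinuousOn (fun z : EuclideanSpace ℝ (Fin d) × ℝ => v z.1 z.2)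
      (Set.univ ×ˢ Set.Icc τ 1))
    (hv_diff : ∀ t ∈ Set.Icc τ 1, Differentiable ℝ (fun y => v y t))
    (hv_deriv : ContinuousOn
      (fun z : EuclideanSpace ℝ (Fin d) × ℝ => fderiv ℝ (fun y => v y z.2) z.1)
      (Set.univ ×ˢ Set.Icc τ 1))
    (hg : Differentiable ℝ g) (hopt : IsOptimalPair f g v τ x X u)
    {a : ℝ → EuclideanSpace ℝ (Fin d)} (ha : IsCostate g v τ X a) :
    ∀ᵐ t ∂(volume.restrict (Set.Icc τ 1)), ∀ y,
      f ‖u (X t) t‖ + inner ℝ (a t) (u (X t) t) ≤ f ‖y‖ + inner ℝ (a t) y := by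
  have hX := hopt.1.continuousOn
  have hac : ContinuousOn a (Set.Icc τ 1) := fun t ht => (ha.ode t ht).continuousWithinAt
  obtain ⟨Ra, hRa⟩ := isCompact_Icc.exists_bound_of_continuousOn hac
  have hRa' : ∀ᵐ t ∂(volume.restrict (Set.Icc τ 1)), ‖a t‖ ≤ Ra := by
    filter_upwards [ae_restrict_mem measurableSet_Icc] with t ht using hRa t ht
  have ham : AEStronglyMeasurable a (volume.restrict (Set.Icc τ 1)) :=
    hac.aestronglyMeasurable measurableSet_Icc
  have hwI : IntegrableOn (fun t => u (X t) t) (Set.Icc τ 1) := hopt.1.control_integrable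
  have hinnerI {z : ℝ → EuclideanSpace ℝ (Fin d)} (hz : IntegrableOn z (Set.Icc τ 1)) :
      IntegrableOn (fun t => (inner ℝ (a t) (z t) : ℝ)) (Set.Icc τ 1) := by
    refine (hz.norm.const_mul Ra).mono' (ham.inner hz.1) ?_
    filter_upwards [hRa'] with t ht
    exact (norm_inner_le_norm _ _).trans (by gcongr)
  have hA : ContinuousOn (fun t => fderiv ℝ (fun y => v y t) (X t)) (Set.Icc τ 1) :=
    hv_deriv.comp (hX.prodMk continuousOn_id) fun t ht => ⟨Set.mem_univ _, ht⟩
  refine ae_minimizes_of_integral_le (continuous_comp_norm hf) ham hRa' hwI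
    hopt.1.cost_integrable ?_
  rintro z hz ⟨N, hN⟩
  have hzI : IntegrableOn z (Set.Icc τ 1) :=
    Integrable.of_bound hz.aestronglyMeasurable N (ae_of_all _ hN)
  have hfzI : IntegrableOn (fun t => f ‖z t‖) (Set.Icc τ 1) :=
    integrable_comp_norm_of_bounded hf hf_mono hz.aestronglyMeasurable (ae_of_all _ hN)
  have hdirI : IntegrableOn (fun t => z t - u (X t) t) (Set.Icc τ 1) := hzI.sub hwI
  -- `ξ` solves the linearized equation; coefficient and forcing are extended to the whole line
  obtain ⟨ξ, hξc, hξ⟩ := exists_continuous_volterra hτ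
    (A := fun t => fderiv ℝ (fun y => v y (Set.projIcc τ 1 hτ t)) (X (Set.projIcc τ 1 hτ t)))
    (hA.comp_continuous (continuous_subtype_val.comp continuous_projIcc)
      fun t => (Set.projIcc τ 1 hτ t).2)
    (b := fun t => ∫ s in τ..t, (Set.Icc τ 1).indicator (fun t => z t - u (X t) t) s)
    (intervalIntegral.continuous_primitive
      (fun _ _ => (hdirI.integrable_indicator measurableSet_Icc).intervalIntegrable) τ)
  have hAI : IntegrableOn (fun t => fderiv ℝ (fun y => v y t) (X t) (ξ t)) (Set.Icc τ 1) :=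
    (hA.clm_apply hξc.continuousOn).integrableOn_Icc
  have hξeq : ∀ t ∈ Set.Icc τ 1, ξ t =
      ∫ s in τ..t, (fderiv ℝ (fun y => v y s) (X s) (ξ s) + (z s - u (X s) s)) := by
    intro t ht
    have hsub {F : ℝ → EuclideanSpace ℝ (Fin d)} (hF : IntegrableOn F (Set.Icc τ 1)) :
        IntervalIntegrable F volume τ t :=
      (intervalIntegrable_iff_integrableOn_Icc_of_le ht.1).2
        (hF.mono_set (Set.Icc_subset_Icc_right ht.2))
    rw [intervalIntegral.integral_add (hsub hAI) (hsub hdirI), add_comm, hξ t ht]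
    have hmem {s : ℝ} (hs : s ∈ Set.uIcc τ t) : s ∈ Set.Icc τ 1 := by
      rw [Set.uIcc_of_le ht.1] at hs
      exact ⟨hs.1, hs.2.trans ht.2⟩
    congr 1
    · refine intervalIntegral.integral_congr fun s hs => ?_
      exact Set.indicator_of_mem (hmem hs) _
    · refine intervalIntegral.integral_congr fun s hs => ?_
      simp only [Set.projIcc_of_mem hτ (hmem hs)]
  have hfirst := integral_cost_le_of_linearized hτ hf hf_convex hf_mono hv_cont hv_diff hv_deriv
    hg hopt hz hN hξc.continuousOn hξeq
  have hξτ : ξ τ = 0 := by simpa using hξeq τ ⟨le_rfl, hτ⟩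
  have hIcc {F : ℝ → ℝ} : ∫ t in τ..1, F t = ∫ t in Set.Icc τ 1, F t := by
    rw [intervalIntegral.integral_of_le hτ, integral_Icc_eq_integral_Ioc]
  have hpc : ContinuousOn (fun t => -(ContinuousLinearMap.adjoint
      (fderiv ℝ (fun y => v y t) (X t)) (a t))) (Set.Icc τ 1) :=
    ((ContinuousLinearMap.adjoint.continuous.comp_continuousOn hA).clm_apply hac).neg
  -- duality: `∫ ⟪a, z - u⟫` equals `⟪∇g (X 1), ξ 1⟫`, since the drift terms cancel
  have hdual := integral_inner_parts_of_primitive hτ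
    (p := fun t => -(ContinuousLinearMap.adjoint (fderiv ℝ (fun y => v y t) (X t)) (a t)))
    (P := a) (Q := ξ) (q := fun s => fderiv ℝ (fun y => v y s) (X s) (ξ s) + (z s - u (X s) s))
    ((intervalIntegrable_iff_integrableOn_Icc_of_le hτ).2 hpc.integrableOn_Icc)
    ((intervalIntegrable_iff_integrableOn_Icc_of_le hτ).2 (hAI.add hdirI))
    (fun t ht => by
      rw [intervalIntegral.integral_eq_sub_of_hasDeriv_right_of_le ht.1
        (f := a) (hac.mono (Set.Icc_subset_Icc_right ht.2)) ?_ ?_]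
      · abel
      · intro s hs
        refine ((ha.ode s ⟨hs.1.le, hs.2.le.trans ht.2⟩).hasDerivAt ?_).hasDerivWithinAt
        exact Icc_mem_nhds hs.1 (hs.2.trans_le ht.2)
      · exact (intervalIntegrable_iff_integrableOn_Icc_of_le ht.1).2
          (hpc.integrableOn_Icc.mono_set (Set.Icc_subset_Icc_right ht.2)))
    (fun t ht => by rw [hξτ, zero_add, hξeq t ht])
  rw [hξτ, inner_zero_right, sub_zero, ha.terminal, hIcc] at hdual
  have hcancel (t : ℝ) : inner ℝ
      (-(ContinuousLinearMap.adjoint (fderiv ℝ (fun y => v y t) (X t)) (a t))) (ξ t) +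
      inner ℝ (a t) (fderiv ℝ (fun y => v y t) (X t) (ξ t) + (z t - u (X t) t)) =
      inner ℝ (a t) (z t) - inner ℝ (a t) (u (X t) t) := by
    rw [inner_neg_left, ContinuousLinearMap.adjoint_inner_left, inner_add_right, inner_sub_right]
    ring
  simp only [hcancel] at hdual
  rw [integral_sub (hinnerI hzI) (hinnerI hwI)] at hdual
  rw [integral_add hopt.1.cost_integrable (hinnerI hwI), integral_add hfzI (hinnerI hzI)]
  linarith

/-- Changing the control along the trajectory on a null set of times preserves optimality. -/
lemma IsOptimalPair.congr_ae (hτ : τ ≤ 1) (hopt : IsOptimalPair f g v τ x X u)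
    {u' : EuclideanSpace ℝ (Fin d) → ℝ → EuclideanSpace ℝ (Fin d)}
    (h : ∀ᵐ t ∂(volume.restrict (Set.Icc τ 1)), u (X t) t = u' (X t) t) :
    IsOptimalPair f g v τ x X u' := by
  have hIoc {t : ℝ} (ht : t ∈ Set.Icc τ 1) : ∀ᵐ s, s ∈ Set.uIoc τ t → u (X s) s = u' (X s) s := by
    rw [ae_restrict_iff' measurableSet_Icc] at h
    filter_upwards [h] with s hs hmem
    rw [Set.uIoc_of_le ht.1] at hmem
    exact hs ⟨hmem.1.le, hmem.2.trans ht.2⟩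
  refine ⟨⟨hopt.1.control_integrable.congr h, hopt.1.cost_integrable.congr ?_,
    hopt.1.continuousOn, fun t ht => ?_⟩, fun X' w hw => ?_⟩
  · filter_upwards [h] with t ht
    rw [ht]
  · rw [hopt.1.dynamics t ht]
    congr 1
    refine intervalIntegral.integral_congr_ae ?_
    filter_upwards [hIoc ht] with s hs hmem
    rw [hs hmem]
  · refine le_of_eq_of_le ?_ (hopt.2 X' w hw)
    unfold controlCost
    congr 1
    refine intervalIntegral.integral_congr_ae ?_
    filter_upwards [hIoc ⟨hτ, le_rfl⟩] with s hs hmem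
    rw [hs hmem]

end Variation

/-! ### The optimal control -/

theorem theorem1 (d : ℕ) (τ : ℝ) (hτ : τ ∈ Set.Ico (0 : ℝ) 1)
    -- the control cost: continuously differentiable, strictly convex and increasing on `[0, ∞)`
    (f : ℝ → ℝ) (hf_smooth : ContDiffOn ℝ 1 f (Set.Ici 0))
    (hf_convex : StrictConvexOn ℝ (Set.Ici 0) f) (hf_mono : MonotoneOn f (Set.Ici 0))
    -- the base velocity: jointly continuous, and continuously differentiable in space
    (v : EuclideanSpace ℝ (Fin d) → ℝ → EuclideanSpace ℝ (Fin d))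
    (hv_cont : ContinuousOn (fun z : EuclideanSpace ℝ (Fin d) × ℝ => v z.1 z.2)
      (Set.univ ×ˢ Set.Icc τ 1))
    (hv_diff : ∀ t ∈ Set.Icc τ 1, Differentiable ℝ (fun y => v y t))
    (hv_deriv : ContinuousOn
      (fun z : EuclideanSpace ℝ (Fin d) × ℝ => fderiv ℝ (fun y => v y z.2) z.1)
      (Set.univ ×ˢ Set.Icc τ 1))
    -- the terminal cost
    (g : EuclideanSpace ℝ (Fin d) → ℝ) (hg : Differentiable ℝ g)
    -- an optimal control and its trajectory, started at `x` at time `τ`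
    (x : EuclideanSpace ℝ (Fin d)) (X : ℝ → EuclideanSpace ℝ (Fin d))
    (u : EuclideanSpace ℝ (Fin d) → ℝ → EuclideanSpace ℝ (Fin d))
    (hopt : IsOptimalPair f g v τ x X u) :
    (∃ a, IsCostate g v τ X a) ∧
    ∀ a, IsCostate g v τ X a →
      -- the inverse of `f'` is meaningful at `‖a t‖`, and the optimal control is the stated one
      (∀ᵐ t ∂(volume.restrict (Set.Icc τ 1)),
        (costDeriv f 0 ≤ ‖a t‖ → ∃ r : ℝ, 0 ≤ r ∧ costDeriv f r = ‖a t‖) ∧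
        u (X t) t = controlLaw f (a t)) ∧
      -- the control given by the formula at every time is itself optimal
      IsOptimalPair f g v τ x X (fun _ t => controlLaw f (a t)) ∧
      -- polynomial cost
      (∀ p lam : ℝ, 1 < p → 0 < lam → (∀ r : ℝ, 0 ≤ r → f r = r ^ p / (p * lam)) →
        ∀ t ∈ Set.Icc τ 1,
          controlLaw f (a t) =
            -((lam ^ (1 / (p - 1)) * ‖a t‖ ^ ((2 - p) / (p - 1))) • a t)) := by
  have hτ' : τ ≤ 1 := hτ.2.le
  have hA : ContinuousOn (fun t => fderiv ℝ (fun y => v y t) (X t)) (Set.Icc τ 1) :=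
    hv_deriv.comp (hopt.1.continuousOn.prodMk continuousOn_id) fun t ht => ⟨Set.mem_univ _, ht⟩
  refine ⟨?_, fun a ha => ?_⟩
  · obtain ⟨a, hode, hterm⟩ := exists_linear_ode_terminal hτ'
      (ContinuousLinearMap.adjoint.continuous.comp_continuousOn hA) (gradient g (X 1))
    exact ⟨a, hode, hterm⟩
  · have hmin := ae_minimizes_hamiltonian hτ' hf_smooth.continuousOn hf_convex hf_mono hv_cont
      hv_diff hv_deriv hg hopt ha
    have hlaw : ∀ᵐ t ∂(volume.restrict (Set.Icc τ 1)),
        (costDeriv f 0 ≤ ‖a t‖ → ∃ r : ℝ, 0 ≤ r ∧ costDeriv f r = ‖a t‖) ∧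
        u (X t) t = controlLaw f (a t) := by
      filter_upwards [hmin] with t ht
      exact eq_controlLaw_of_minimizes (hf_smooth.differentiableOn one_ne_zero) hf_convex
        hf_mono ht
    exact ⟨hlaw, hopt.congr_ae hτ' (hlaw.mono fun t ht => ht.2),
      fun p lam hp hlam hf t _ => controlLaw_of_eq_rpow hp hlam hf (a t)⟩
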